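/- Let $K$ be a field, let $n,t$ be integers with $1<t<n-1$, and let $d=\gcd(n,t)$. Let $S=K[x_1,\dots,x_n]$, with the indices of all variables taken modulo $n$, let $C_n$ be the cycle on the vertices $x_1,\dots,x_n$, and let $I=I_t(C_n)\subset S$ be its $t$-path ideal, that is, the ideal generated by the products of the vertices of all paths of $C_n$ on $t$ vertices. Let $u_j=x_jx_{j+1}\cdots x_{j+t-1}\in I$ for $j=1,\dots,n$. Let $R(I)=\bigoplus_{k\ge 0}I^ks^k\subset S[s]$ be the Rees algebra of $I$, let $\mathfrak m=(x_1,\dots,x_n)$, and let $F(I)=R(I)/\mathfrak m R(I)$ be the fiber cone of $I$. For $i=1,\dots,d$ put $$m_i=\prod_{\substack{1\le j\le n\\ j\equiv i \pmod d}} y_j\in K[y_1,\dots,y_n].$$ Then the $K$-algebra homomorphism $\varphi'\colon K[y_1,\dots,y_n]\to F(I)$ that sends $y_j$ to the class of $u_js$ is surjective, and its kernel (the defining ideal of the fiber cone) is $$H=(m_1-m_d,\;m_2-m_d,\;\dots,\;m_{d-1}-m_d)$$ (so $H=0$ if $d=1$). Under the identification $F(I)\cong K[u_1,\dots,u_n]\subset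 S$, the same holds for the homomorphism $K[y_1,\dots,y_n]\to S$, $y_j\mapsto u_j$: its kernel is the same ideal $H$. -/

import Mathlib

open MvPolynomial

noncomputable section

/-- The `t`-path ideal of a simple graph `G` in the polynomial ring `K[x_v : v ∈ V]`: the ideal
generated by the squarefree monomials `x_{v_1} ⋯ x_{v_t}`, where `v_1, …, v_t` is the sequence of
vertices of a path of `G` on `t` (distinct) vertices. -/
def pathIdeal {V : Type*} (K : Type*) [Field K] (G : SimpleGraph V) (t : ℕ) :
    Ideal (MvPolynomial V K) :=
  Ideal.span {f | ∃ (v w : V) (p : G.Walk v w), p.IsPath ∧ p.support.length = t ∧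
    f = (p.support.map fun a => (X a : MvPolynomial V K)).prod}

/-- The cycle `C_n` on the vertex set `ℤ/n`: distinct vertices are adjacent
when they differ by `1`. -/
def cycleMod (n : ℕ) : SimpleGraph (ZMod n) :=
  SimpleGraph.circulantGraph {1}

/-- The monomial `x_j x_{j+1} ⋯ x_{j+t-1}`, with indices modulo `n`. -/
def cyclePathMonomial (K : Type*) [Field K] (n t : ℕ) (j : ZMod n) : MvPolynomial (ZMod n) K :=
  ∏ k ∈ Finset.range t, X (j + (k : ZMod n))

/-- The fiber cone `F(I) = R(I) / 𝔪 R(I)` of an ideal `I` of a polynomial ring, where `R(I)` is the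
Rees algebra of `I` and `𝔪` is the ideal generated by all variables. -/
abbrev FiberCone {V K : Type*} [Field K] (I : Ideal (MvPolynomial V K)) :=
  reesAlgebra I ⧸ (idealOfVars V K).map
    (algebraMap (MvPolynomial V K) (reesAlgebra I))

/-- The degree one element `u s` of the Rees algebra of `I`, for `u ∈ I`. -/
def reesGen {S : Type*} [CommRing S] {I : Ideal S} (u : I) : reesAlgebra I :=
  ⟨Polynomial.monomial 1 (u : S), reesAlgebra.monomial_mem.mpr (by rw [pow_one]; exact u.2)⟩

/-- The `K`-algebra homomorphism `K[y_i : i ∈ ι] → F(I)` that sends `y_i` to the residue class of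
`u_i s`, for a family of elements `u_i` of `I`. -/
def fiberConeMap {V K ι : Type*} [Field K] {I : Ideal (MvPolynomial V K)} (u : ι → I) :
    MvPolynomial ι K →ₐ[K] FiberCone I :=
  aeval fun i => Ideal.Quotient.mk _ (reesGen (u i))

theorem exists_cycleMod_walk {n : ℕ} (hn : 1 < n) (k : ℕ) (a : ZMod n) :
    ∃ (v : ZMod n) (p : (cycleMod n).Walk a v),
      p.support = (List.range (k + 1)).map fun i : ℕ => a + (i : ZMod n) := by
  induction k generalizing a with
  | zero => exact ⟨a, .nil, by simp⟩
  | succ k ih =>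
    obtain ⟨v, p, hp⟩ := ih (a + 1)
    have : Fact (1 < n) := ⟨hn⟩
    have h : (cycleMod n).Adj a (a + 1) := by
      simp [cycleMod, SimpleGraph.circulantGraph_adj]
    refine ⟨v, .cons h p, ?_⟩
    rw [SimpleGraph.Walk.support_cons, hp, List.range_succ_eq_map (n := k + 1)]
    simp only [List.map_cons, List.map_map, Function.comp_def, Nat.cast_zero, add_zero,
      Nat.cast_succ, List.cons.injEq, true_and]
    exact List.map_congr_left fun i _ => by ring

theorem cyclePathMonomial_mem (K : Type*) [Field K] {n t : ℕ} (ht : 1 < t) (htn : t + 1 < n)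
    (j : ZMod n) : cyclePathMonomial K n t j ∈ pathIdeal K (cycleMod n) t := by
  obtain ⟨v, p, hp⟩ := exists_cycleMod_walk (by omega : 1 < n) (t - 1) j
  rw [Nat.sub_add_cancel (by omega)] at hp
  refine Ideal.subset_span ⟨j, v, p, ?_, by simp [hp], ?_⟩
  · rw [SimpleGraph.Walk.isPath_def, hp]
    refine List.Nodup.map_on ?_ List.nodup_range
    intro x hx y hy hxy
    rw [List.mem_range] at hx hy
    have h := (ZMod.natCast_eq_natCast_iff' x y n).mp (add_left_cancel hxy)
    rwa [Nat.mod_eq_of_lt (by omega), Nat.mod_eq_of_lt (by omega)] at h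
  · rw [hp, List.map_map, cyclePathMonomial, Finset.prod_range]
    rw [← List.prod_ofFn, List.ofFn_eq_map]
    rw [← List.map_coe_finRange_eq_range, List.map_map]
    rfl

/-- The generator `x_j ⋯ x_{j+t-1}` as an element of the path ideal `I_t(C_n)`. -/
def cyclePathGen (K : Type*) [Field K] {n t : ℕ} (ht : 1 < t) (htn : t + 1 < n) (j : ZMod n) :
    pathIdeal K (cycleMod n) t :=
  ⟨cyclePathMonomial K n t j, cyclePathMonomial_mem K ht htn j⟩

/-- The monomial `m_i`, the product of the `y_j` with `1 ≤ j ≤ n` and `j ≡ i (mod d)`. The variables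
`y_1, …, y_n` are indexed by the residue classes modulo `n`. -/
def residueMonomial (K : Type*) [Field K] (n d i : ℕ) : MvPolynomial (ZMod n) K :=
  ∏ j ∈ Finset.Icc 1 n with j ≡ i [MOD d], X (j : ZMod n)

end

/-! All u_j are forms of degree t. Coefficients of s^k in 𝔪R(I) lie in 𝔪^(tk+1), while a degree k
form in the u_j has degree tk, so the fiber cone has the same relations as K[u_1, …, u_n]
(`ker_fiberConeMap`).

The kernel of the monomial map y_j ↦ u_j is governed by pairs of exponent vectors a, b with equal
image. The exponent of x_v in the image is the sum of a over the window v, v-1, …, v-t+1, so c = a -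
b has vanishing window sums. Comparing neighbouring windows gives c(v-t) = c(v), hence c is constant
on residue classes modulo d. Both monomials are then a common monomial times equally many factors
m_i, and they agree modulo H (`mk_monomial_eq_of_linearCombination_eq`). Conversely, the m_i have
equal images, by multiplying u_{j+1} x_j = u_j x_{j+t} over a class (`aeval_classMonomial_succ`). -/

/-! ### Paths of the cycle and generators of the path ideal. -/

/-- A path in the cycle runs in a constant direction. -/
theorem cycleMod_support_of_isPath {n : ℕ} {a b : ZMod n} (p : (cycleMod n).Walk a b)
    (hp : p.IsPath) : ∃ e : ZMod n, (e = 1 ∨ e = -1) ∧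
      p.support = (List.range (p.length + 1)).map fun i : ℕ => a + (i : ZMod n) * e := by
  induction p with
  | nil => exact ⟨1, by simp⟩
  | @cons a c b h p ih =>
    rw [SimpleGraph.Walk.cons_isPath_iff] at hp
    obtain ⟨e, he, hs⟩ := ih hp.1
    have hadj : ∃ e' : ZMod n, (e' = 1 ∨ e' = -1) ∧ c = a + e' := by
      rw [cycleMod, SimpleGraph.circulantGraph_adj] at h
      rcases h.2 with h | h
      · exact ⟨-1, .inr rfl, by rw [← Set.mem_singleton_iff.mp h]; ring⟩
      · exact ⟨1, .inl rfl, by rw [← Set.mem_singleton_iff.mp h]; ring⟩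
    obtain ⟨e', he', rfl⟩ := hadj
    have key : p.support =
        (List.range (p.length + 1)).map fun i : ℕ => a + e' + (i : ZMod n) * e' := by
      -- A one-vertex tail has no direction of its own, so its `e` is replaced by `e'`.
      rcases Nat.eq_zero_or_pos p.length with h0 | h0
      · rw [hs, h0]; simp
      · suffices e = e' by rw [hs, this]
        by_contra hne
        have hsum : e' + e = 0 := by
          rcases he with rfl | rfl <;> rcases he' with rfl | rfl <;> simp_all
        -- If the direction changed, the tail's vertex of index 1 would be a + e' + e = a again.
        refine hp.2 ?_
        rw [hs, List.mem_map]
        exact ⟨1, by rw [List.mem_range]; omega, by linear_combination hsum⟩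
    refine ⟨e', he', ?_⟩
    rw [SimpleGraph.Walk.support_cons, key, SimpleGraph.Walk.length_cons,
      List.range_succ_eq_map (n := p.length + 1)]
    simp only [List.map_cons, List.map_map, Function.comp_def, Nat.cast_zero, zero_mul, add_zero,
      Nat.cast_succ, List.cons.injEq, true_and]
    exact List.map_congr_left fun i _ => by ring

theorem List.prod_map_range_eq_prod {M : Type*} [CommMonoid M] (n : ℕ) (f : ℕ → M) :
    ((List.range n).map f).prod = ∏ i ∈ Finset.range n, f i := by
  induction n with
  | zero => simp
  | succ n ih => rw [List.range_succ, Finset.prod_range_succ]; simp [ih]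

theorem prod_support_eq_cyclePathMonomial (K : Type*) [Field K] {n : ℕ} {a b : ZMod n}
    (p : (cycleMod n).Walk a b) (hp : p.IsPath) :
    ∃ j, (p.support.map fun a => (X a : MvPolynomial (ZMod n) K)).prod =
      cyclePathMonomial K n (p.length + 1) j := by
  obtain ⟨e, rfl | rfl, hs⟩ := cycleMod_support_of_isPath p hp
  · refine ⟨a, ?_⟩
    rw [hs, List.map_map, List.prod_map_range_eq_prod, cyclePathMonomial]
    simp
  · refine ⟨a - p.length, ?_⟩
    rw [hs, List.map_map, List.prod_map_range_eq_prod, cyclePathMonomial,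
      ← Finset.prod_range_reflect]
    refine Finset.prod_congr rfl fun k hk => ?_
    rw [Finset.mem_range] at hk
    rw [Function.comp_apply, show p.length + 1 - 1 - k = p.length - k by omega,
      Nat.cast_sub (by omega)]
    congr 1
    ring

theorem pathIdeal_cycleMod_eq_span (K : Type*) [Field K] {n t : ℕ} (ht : 1 < t)
    (htn : t + 1 < n) :
    pathIdeal K (cycleMod n) t = Ideal.span (Set.range (cyclePathMonomial K n t)) := by
  apply le_antisymm
  · rw [pathIdeal, Ideal.span_le]
    rintro _ ⟨a, b, p, hp, hlen, rfl⟩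
    obtain ⟨j, hj⟩ := prod_support_eq_cyclePathMonomial K p hp
    rw [SimpleGraph.Walk.length_support] at hlen
    rw [hj, hlen]
    exact Ideal.subset_span ⟨j, rfl⟩
  · rw [Ideal.span_le]
    rintro _ ⟨j, rfl⟩
    exact cyclePathMonomial_mem K ht htn j

/-! ### Fiber cones of ideals generated by forms of one degree. -/

section FiberCone

variable {V K ι : Type*} [Field K] {I : Ideal (MvPolynomial V K)}

theorem sub_C_constantCoeff_mem_idealOfVars (f : MvPolynomial V K) :
    f - C (constantCoeff f) ∈ idealOfVars V K := by
  rw [← pow_one (idealOfVars V K), mem_pow_idealOfVars_iff]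
  intro x hx
  rw [Nat.one_le_iff_ne_zero, ne_eq, Finsupp.degree_eq_zero_iff]
  rintro rfl
  simp [mem_support_iff, constantCoeff_eq] at hx

theorem FiberCone.mk_algebraMap (f : MvPolynomial V K) :
    (Ideal.Quotient.mk _ (algebraMap _ (reesAlgebra I) f) : FiberCone I) =
      algebraMap K (FiberCone I) (constantCoeff f) := by
  have h := Ideal.mem_map_of_mem (algebraMap (MvPolynomial V K) (reesAlgebra I))
    (sub_C_constantCoeff_mem_idealOfVars f)
  rw [map_sub] at h
  exact Ideal.Quotient.eq.mpr h

/-- The Rees algebra is generated over S by I s, and S acts on the fiber cone through constant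
terms, so K-combinations suffice. -/
theorem fiberConeMap_surjective (u : ι → I)
    (hI : I ≤ Ideal.span (Set.range fun i => (u i : MvPolynomial V K))) :
    Function.Surjective (fiberConeMap u) := by
  set A := (fiberConeMap u).range with hA
  have hscal (f : MvPolynomial V K) :
      (Ideal.Quotient.mk _ (algebraMap _ (reesAlgebra I) f) : FiberCone I) ∈ A := by
    rw [FiberCone.mk_algebraMap]
    exact A.algebraMap_mem _
  have hgen (f : MvPolynomial V K) (hf : f ∈ Ideal.span (Set.range fun i =>
      (u i : MvPolynomial V K))) : ∃ r : reesAlgebra I,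
      (r : Polynomial (MvPolynomial V K)) = Polynomial.monomial 1 f ∧
        (Ideal.Quotient.mk _ r : FiberCone I) ∈ A := by
    induction hf using Submodule.span_induction with
    | mem x hx =>
      obtain ⟨i, rfl⟩ := hx
      exact ⟨reesGen (u i), rfl, X i, by simp [fiberConeMap]⟩
    | zero => exact ⟨0, by simp, by rw [map_zero]; exact A.zero_mem⟩
    | add x y _ _ hx hy =>
      obtain ⟨r, hr, hr'⟩ := hx
      obtain ⟨s, hs, hs'⟩ := hy
      exact ⟨r + s, by simp [hr, hs], by rw [map_add]; exact A.add_mem hr' hs'⟩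
    | smul a x _ hx =>
      obtain ⟨r, hr, hr'⟩ := hx
      refine ⟨algebraMap _ _ a * r, ?_, by rw [map_mul]; exact A.mul_mem (hscal a) hr'⟩
      rw [← Algebra.smul_def]
      simp [hr, Polynomial.smul_monomial]
  have key (p : Polynomial (MvPolynomial V K)) (hp : p ∈ reesAlgebra I) :
      ∃ r : reesAlgebra I, (r : Polynomial (MvPolynomial V K)) = p ∧
        (Ideal.Quotient.mk _ r : FiberCone I) ∈ A := by
    rw [← adjoin_monomial_eq_reesAlgebra] at hp
    induction hp using Algebra.adjoin_induction with
    | mem x hx =>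
      obtain ⟨f, hf, rfl⟩ := hx
      exact hgen f (hI hf)
    | algebraMap f => exact ⟨algebraMap _ _ f, rfl, hscal f⟩
    | add x y _ _ hx hy =>
      obtain ⟨r, hr, hr'⟩ := hx
      obtain ⟨s, hs, hs'⟩ := hy
      exact ⟨r + s, by simp [hr, hs], by rw [map_add]; exact A.add_mem hr' hs'⟩
    | mul x y _ _ hx hy =>
      obtain ⟨r, hr, hr'⟩ := hx
      obtain ⟨s, hs, hs'⟩ := hy
      exact ⟨r * s, by simp [hr, hs], by rw [map_mul]; exact A.mul_mem hr' hs'⟩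
  intro z
  obtain ⟨r, rfl⟩ := Ideal.Quotient.mk_surjective z
  obtain ⟨s, hs, hs'⟩ := key r r.2
  rwa [Subtype.ext hs] at hs'

theorem fiberConeMap_eq_mk_aeval (u : ι → I) (f : MvPolynomial ι K) :
    fiberConeMap u f = Ideal.Quotient.mk _ (aeval (fun i => reesGen (u i)) f) := by
  have : fiberConeMap u = (Ideal.Quotient.mkₐ K _).comp (aeval fun i => reesGen (u i)) := by
    ext i
    simp [fiberConeMap]
  rw [this]
  rfl

theorem coeff_aeval_reesGen (u : ι → I) (f : MvPolynomial ι K) (k : ℕ) :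
    (aeval (fun i => reesGen (u i)) f : reesAlgebra I).1.coeff k =
      aeval (fun i => (u i : MvPolynomial V K)) (homogeneousComponent k f) := by
  have h1 (f : MvPolynomial ι K) : ((aeval (fun i => reesGen (u i)) f : reesAlgebra I) :
      Polynomial (MvPolynomial V K)) =
      aeval (fun i => Polynomial.monomial 1 (u i : MvPolynomial V K)) f := by
    have : ((reesAlgebra I).val.restrictScalars K).comp (aeval fun i => reesGen (u i)) =
        aeval (fun i => Polynomial.monomial 1 (u i : MvPolynomial V K)) := by
      ext i : 1
      simp [reesGen]
    exact DFunLike.congr_fun this f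
  rw [h1]
  clear h1
  induction f using MvPolynomial.induction_on' with
  | add p q hp hq => simp only [map_add, Polynomial.coeff_add, hp, hq]
  | monomial a c =>
    have hm : (∏ i ∈ a.support, Polynomial.monomial 1 (u i : MvPolynomial V K) ^ a i) =
        Polynomial.monomial a.degree (∏ i ∈ a.support, (u i : MvPolynomial V K) ^ a i) := by
      simp only [← Polynomial.C_mul_X_pow_eq_monomial, mul_pow, pow_one, Finset.prod_mul_distrib,
        Finset.prod_pow_eq_pow_sum, map_prod, map_pow]
      rfl
    rw [homogeneousComponent_of_mem (n := a.degree) (isHomogeneous_monomial c rfl),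
      aeval_monomial, Finsupp.prod, hm, ← Algebra.smul_def, Polynomial.coeff_smul,
      Polynomial.coeff_monomial]
    split_ifs with h h' h'
    · rw [aeval_monomial, Finsupp.prod, ← Algebra.smul_def]
    · exact absurd h.symm h'
    · exact absurd h'.symm h
    · simp

/-- The s^k-coefficients of R(I) lie in I^k ⊆ 𝔪^(tk), and a factor from 𝔪 raises the order by one.
-/
theorem coeff_mem_of_mem_map_idealOfVars {t : ℕ} (hI : I ≤ idealOfVars V K ^ t)
    (r : reesAlgebra I) (hr : r ∈ (idealOfVars V K).map (algebraMap _ (reesAlgebra I))) (k : ℕ) :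
    r.1.coeff k ∈ idealOfVars V K ^ (t * k + 1) := by
  have hpow (i : ℕ) : I ^ i ≤ idealOfVars V K ^ (t * i) := by
    rw [pow_mul]
    exact Ideal.pow_right_mono hI i
  rw [Ideal.map] at hr
  induction hr using Submodule.span_induction generalizing k with
  | mem x hx =>
    obtain ⟨f, hf, rfl⟩ := hx
    change (Polynomial.C f).coeff k ∈ _
    rw [Polynomial.coeff_C]
    split_ifs with h
    · simpa [h] using hf
    · exact Ideal.zero_mem _
  | zero => exact Ideal.zero_mem _
  | add x y _ _ hx hy =>
    change (x.1 + y.1).coeff k ∈ _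
    rw [Polynomial.coeff_add]
    exact Ideal.add_mem _ (hx k) (hy k)
  | smul a x _ hx =>
    change (a.1 * x.1).coeff k ∈ _
    rw [Polynomial.coeff_mul]
    refine Ideal.sum_mem _ fun ij hij => ?_
    rw [Finset.HasAntidiagonal.mem_antidiagonal] at hij
    have := Ideal.mul_mem_mul (hpow _ ((mem_reesAlgebra_iff I a.1).mp a.2 ij.1)) (hx ij.2)
    rwa [← pow_add, ← add_assoc, ← mul_add, hij] at this

theorem MvPolynomial.IsHomogeneous.eq_zero_of_mem_idealOfVars_pow {p : MvPolynomial V K} {m l : ℕ}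
    (hp : p.IsHomogeneous m) (hl : m < l) (h : p ∈ idealOfVars V K ^ l) : p = 0 := by
  rw [mem_pow_idealOfVars_iff] at h
  by_contra h0
  obtain ⟨x, hx⟩ := Finset.nonempty_iff_ne_empty.mpr (mt support_eq_empty.mp h0)
  have h1 := h x hx
  have h2 := hp (mem_support_iff.mp hx)
  rw [show Finsupp.weight (1 : V → ℕ) x = x.degree from
    (DFunLike.congr_fun Finsupp.degree_eq_weight_one x).symm] at h2
  omega

theorem MvPolynomial.IsHomogeneous.mem_idealOfVars_pow {p : MvPolynomial V K} {m : ℕ}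
    (hp : p.IsHomogeneous m) : p ∈ idealOfVars V K ^ m := by
  rw [mem_pow_idealOfVars_iff]
  intro x hx
  have h2 := hp (mem_support_iff.mp hx)
  rw [show Finsupp.weight (1 : V → ℕ) x = x.degree from
    (DFunLike.congr_fun Finsupp.degree_eq_weight_one x).symm] at h2
  exact h2.ge

theorem homogeneousComponent_aeval {t : ℕ} (ht : 0 < t) (g : ι → MvPolynomial V K)
    (hg : ∀ i, (g i).IsHomogeneous t) (f : MvPolynomial ι K) (k : ℕ) :
    homogeneousComponent (t * k) (aeval g f) = aeval g (homogeneousComponent k f) := by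
  induction f using MvPolynomial.induction_on' with
  | add p q hp hq => simp only [map_add, hp, hq]
  | monomial a c =>
    have ha : (monomial a c).IsHomogeneous a.degree := isHomogeneous_monomial c rfl
    rw [homogeneousComponent_of_mem ha, homogeneousComponent_of_mem (ha.aeval g hg)]
    by_cases h : k = a.degree
    · simp [h]
    · rw [if_neg h, if_neg (fun h' => h (Nat.eq_of_mul_eq_mul_left ht h')), map_zero]

/-- For an ideal generated by forms of the same degree, the fiber cone is the algebra generated by
these forms. -/
theorem ker_fiberConeMap {t : ℕ} (ht : 0 < t) (u : ι → I)
    (hI : I ≤ Ideal.span (Set.range fun i => (u i : MvPolynomial V K)))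
    (hu : ∀ i, (u i : MvPolynomial V K).IsHomogeneous t) :
    RingHom.ker (fiberConeMap u) =
      RingHom.ker (aeval fun i => (u i : MvPolynomial V K) :
        MvPolynomial ι K →ₐ[K] MvPolynomial V K) := by
  have hIt : I ≤ idealOfVars V K ^ t := by
    refine hI.trans (Ideal.span_le.mpr ?_)
    rintro _ ⟨i, rfl⟩
    exact (hu i).mem_idealOfVars_pow
  ext f
  rw [RingHom.mem_ker, RingHom.mem_ker, fiberConeMap_eq_mk_aeval]
  constructor
  · intro h
    have hmem := Ideal.Quotient.eq_zero_iff_mem.mp h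
    rw [← sum_homogeneousComponent f, map_sum]
    refine Finset.sum_eq_zero fun k _ => ?_
    have hk := coeff_mem_of_mem_map_idealOfVars hIt _ hmem k
    rw [coeff_aeval_reesGen] at hk
    exact ((homogeneousComponent_isHomogeneous k f).aeval _ hu).eq_zero_of_mem_idealOfVars_pow
      (Nat.lt_succ_self _) hk
  · intro h
    suffices aeval (fun i => reesGen (u i)) f = (0 : reesAlgebra I) by rw [this, map_zero]
    refine Subtype.ext (Polynomial.ext fun k => ?_)
    -- Since t > 0, distinct degrees k have images in distinct degrees tk, so each component of a
    -- relation is a relation.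
    rw [coeff_aeval_reesGen, ← homogeneousComponent_aeval ht _ hu, h, map_zero]
    rfl

end FiberCone

/-! ### Kernels of monomial maps. -/

theorem aeval_monomial_one {σ ι K : Type*} [Field K] (w : ι → σ →₀ ℕ) (a : ι →₀ ℕ) :
    aeval (fun i => (monomial (w i) 1 : MvPolynomial σ K)) (monomial a (1 : K)) =
      monomial (Finsupp.linearCombination ℕ w a) 1 := by
  rw [aeval_monomial, map_one, one_mul, Finsupp.linearCombination_apply, monomial_finsupp_sum_index]
  simp [monomial_pow]

/-- The kernel of a monomial map is contained in each ideal that identifies the monomials with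
equal images. -/
theorem ker_aeval_monomial_le {σ ι K : Type*} [Field K] (w : ι → σ →₀ ℕ)
    (J : Ideal (MvPolynomial ι K))
    (h : ∀ a b, Finsupp.linearCombination ℕ w a = Finsupp.linearCombination ℕ w b →
      (Ideal.Quotient.mk J (monomial a 1)) = Ideal.Quotient.mk J (monomial b 1)) :
    RingHom.ker (aeval fun i => (monomial (w i) 1 : MvPolynomial σ K) :
      MvPolynomial ι K →ₐ[K] MvPolynomial σ K) ≤ J := by
  -- The quotient map factors through the monomial map via `s`, which sends a monomial to the class
  -- of a chosen preimage. Values off the image are irrelevant.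
  let s : MvPolynomial σ K →ₗ[K] MvPolynomial ι K ⧸ J :=
    (basisMonomials σ K).constr K fun m =>
      Ideal.Quotient.mk J (monomial (Function.invFun (Finsupp.linearCombination ℕ w) m) 1)
  have hs : s ∘ₗ (aeval fun i => (monomial (w i) 1 : MvPolynomial σ K)).toLinearMap =
      (Ideal.Quotient.mkₐ K J).toLinearMap := by
    refine (basisMonomials ι K).ext fun a => ?_
    rw [coe_basisMonomials, LinearMap.comp_apply, AlgHom.toLinearMap_apply, aeval_monomial_one]
    have := (basisMonomials σ K).constr_basis K (fun m => Ideal.Quotient.mk J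
      (monomial (Function.invFun (Finsupp.linearCombination ℕ w) m) (1 : K)))
      (Finsupp.linearCombination ℕ w a)
    rw [coe_basisMonomials] at this
    exact this.trans (h _ _ (Function.invFun_eq ⟨a, rfl⟩))
  intro f hf
  have h1 := DFunLike.congr_fun hs f
  rw [LinearMap.comp_apply, AlgHom.toLinearMap_apply, RingHom.mem_ker.mp hf, map_zero] at h1
  exact Ideal.Quotient.eq_zero_iff_mem.mp h1.symm

/-- The sum of c over v, v-1, …, v-t splits off its last or its first term, leaving a vanishing
window either way. -/
theorem sub_natCast_eq_of_sum_range_eq_zero {n t : ℕ} (c : ZMod n → ℤ)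
    (hc : ∀ v, ∑ k ∈ Finset.range t, c (v - k) = 0) (v : ZMod n) : c (v - t) = c v := by
  have h1 := Finset.sum_range_succ (fun k : ℕ => c (v - k)) t
  have h2 := Finset.sum_range_succ' (fun k : ℕ => c (v - k)) t
  have h3 : ∑ k ∈ Finset.range t, c (v - ((k + 1 : ℕ) : ZMod n)) = 0 := by
    rw [← hc (v - 1)]
    refine Finset.sum_congr rfl fun k _ => ?_
    congr 1
    push_cast
    ring
  rw [hc v] at h1
  simp only [h3, Nat.cast_zero, sub_zero] at h2
  linarith

/-! ### Residue classes modulo gcd(n, t) and the kernel for the cycle. -/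

section Cycle

variable {n : ℕ} [NeZero n]

/-- The exponent vector of `x_j ⋯ x_{j+t-1}`. -/
noncomputable def cyclePathExponent (n t : ℕ) (j : ZMod n) : ZMod n →₀ ℕ :=
  ∑ k ∈ Finset.range t, Finsupp.single (j + (k : ZMod n)) 1

theorem cyclePathMonomial_eq_monomial (K : Type*) [Field K] (n t : ℕ) (j : ZMod n) :
    cyclePathMonomial K n t j = monomial (cyclePathExponent n t j) 1 := by
  rw [cyclePathExponent, monomial_sum_one]
  rfl

theorem linearCombination_cyclePathExponent_apply (t : ℕ) (a : ZMod n →₀ ℕ) (v : ZMod n) :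
    Finsupp.linearCombination ℕ (cyclePathExponent n t) a v =
      ∑ k ∈ Finset.range t, a (v - k) := by
  rw [Finsupp.linearCombination_apply, Finsupp.sum_fintype _ _ (by simp), Finsupp.finsetSum_apply]
  simp only [Finsupp.smul_apply, cyclePathExponent, Finsupp.finsetSum_apply, smul_eq_mul,
    Finset.mul_sum, Finsupp.single_apply]
  rw [Finset.sum_comm]
  refine Finset.sum_congr rfl fun k _ => ?_
  simp only [← eq_sub_iff_add_eq, mul_ite, mul_one, mul_zero, Finset.sum_ite_eq',
    Finset.mem_univ, if_true]

/-- A `t`-periodic function on `ℤ/n` is constant on the residue classes modulo `gcd n t`. -/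
theorem eq_of_castHom_eq {α : Type*} {t d : ℕ} (hd : d = Nat.gcd n t) (hdn : d ∣ n)
    (c : ZMod n → α) (hc : ∀ v, c (v - t) = c v) {v w : ZMod n}
    (h : ZMod.castHom hdn (ZMod d) v = ZMod.castHom hdn (ZMod d) w) : c v = c w := by
  have hmul (m : ℕ) (v : ZMod n) : c (v - m * t) = c v := by
    induction m with
    | zero => simp
    | succ m ih => rw [← ih, ← hc (v - m * t)]; congr 1; push_cast; ring
  have hz : ∃ z : ZMod n, w = v - z * t := by
    have h0 : ZMod.castHom hdn (ZMod d) (v - w) = 0 := by rw [map_sub, h, sub_self]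
    obtain ⟨x, hx⟩ := ZMod.natCast_zmod_surjective (v - w)
    rw [← hx, map_natCast, ZMod.natCast_eq_zero_iff] at h0
    obtain ⟨y, rfl⟩ := h0
    -- Bézout, with the multiple of n vanishing in ℤ/n.
    have hb : (d : ZMod n) = t * (Nat.gcdB n t : ℤ) := by
      have := congrArg (Int.cast : ℤ → ZMod n) (Nat.gcd_eq_gcd_ab n t)
      rw [← hd] at this
      push_cast at this
      simpa using this
    refine ⟨y * (Nat.gcdB n t : ℤ), ?_⟩
    push_cast at hx
    rw [hb] at hx
    linear_combination hx
  obtain ⟨z, rfl⟩ := hz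
  obtain ⟨m, rfl⟩ := ZMod.natCast_zmod_surjective z
  rw [hmul]

theorem sum_sum_range_sub {t : ℕ} (c : ZMod n → ℤ) :
    ∑ v, ∑ k ∈ Finset.range t, c (v - k) = t * ∑ v, c v := by
  rw [Finset.sum_comm]
  have (k : ℕ) : ∑ v, c (v - (k : ZMod n)) = ∑ v, c v :=
    (Equiv.subRight (k : ZMod n)).sum_comp c
  simp [this]

/-- The product of the variables in a residue class modulo `d`. -/
noncomputable def classMonomial (K : Type*) [Field K] {d : ℕ} (hdn : d ∣ n) (r : ZMod d) :
    MvPolynomial (ZMod n) K :=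
  ∏ v with ZMod.castHom hdn (ZMod d) v = r, X v

theorem residueMonomial_eq_classMonomial (K : Type*) [Field K] {d : ℕ} (hdn : d ∣ n) (i : ℕ) :
    residueMonomial K n d i = classMonomial K hdn (i : ZMod d) := by
  refine Finset.prod_bij (fun j _ => (j : ZMod n)) ?_ ?_ ?_ (fun _ _ => rfl)
  · intro j hj
    rw [Finset.mem_filter] at hj ⊢
    rw [map_natCast]
    exact ⟨Finset.mem_univ _, (ZMod.natCast_eq_natCast_iff _ _ _).mpr hj.2⟩
  · intro j hj k hk h
    rw [Finset.mem_filter, Finset.mem_Icc] at hj hk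
    exact Nat.ModEq.eq_of_abs_lt ((ZMod.natCast_eq_natCast_iff _ _ _).mp h)
      (by rw [abs_lt]; omega)
  · intro v hv
    rw [Finset.mem_filter] at hv
    have hn : 0 < n := NeZero.pos n
    obtain ⟨j, hj, rfl⟩ : ∃ j ∈ Finset.Icc 1 n, (j : ZMod n) = v := by
      by_cases h0 : v = 0
      -- In the range 1, …, n the class 0 is represented by n.
      · exact ⟨n, by simpa [Nat.one_le_iff_ne_zero] using hn.ne', by simp [h0]⟩
      · refine ⟨v.val, ?_, ZMod.natCast_zmod_val v⟩
        rw [Finset.mem_Icc]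
        exact ⟨Nat.one_le_iff_ne_zero.mpr (mt (ZMod.val_eq_zero v).mp h0), (ZMod.val_lt v).le⟩
    refine ⟨j, ?_, rfl⟩
    rw [Finset.mem_filter]
    rw [map_natCast] at hv
    exact ⟨hj, (ZMod.natCast_eq_natCast_iff _ _ _).mp hv.2⟩

theorem cyclePathMonomial_succ_mul (K : Type*) [Field K] (n t : ℕ) (j : ZMod n) :
    cyclePathMonomial K n t (j + 1) * X j = cyclePathMonomial K n t j * X (j + t) := by
  have h1 := Finset.prod_range_succ (fun k : ℕ => (X (j + k) : MvPolynomial (ZMod n) K)) t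
  have h2 := Finset.prod_range_succ' (fun k : ℕ => (X (j + k) : MvPolynomial (ZMod n) K)) t
  rw [h1] at h2
  rw [cyclePathMonomial, cyclePathMonomial, h2, Nat.cast_zero, add_zero]
  congr 1
  refine Finset.prod_congr rfl fun k _ => ?_
  push_cast
  ring_nf

theorem prod_class_add {M : Type*} [CommMonoid M] {d : ℕ} (hdn : d ∣ n) (r : ZMod d) (s : ZMod n)
    (f : ZMod n → M) :
    ∏ v with ZMod.castHom hdn (ZMod d) v = r, f (v + s) =
      ∏ v with ZMod.castHom hdn (ZMod d) v = r + ZMod.castHom hdn (ZMod d) s, f v := by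
  refine Finset.prod_equiv (Equiv.addRight s) (fun v => ?_) (fun _ _ => rfl)
  simp only [Finset.mem_filter, Finset.mem_univ, true_and, Equiv.coe_addRight, map_add,
    add_left_inj]

/-- As d divides t, the shift by t permutes each class, so the factors x_j and x_{j+t} have the same
product over the class and cancel. -/
theorem aeval_classMonomial_succ (K : Type*) [Field K] {t d : ℕ} (hdn : d ∣ n) (hdt : d ∣ t)
    (r : ZMod d) :
    aeval (cyclePathMonomial K n t) (classMonomial K hdn (r + 1)) =
      aeval (cyclePathMonomial K n t) (classMonomial K hdn r) := by
  have h (r : ZMod d) : aeval (cyclePathMonomial K n t) (classMonomial K hdn r) =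
      ∏ v with ZMod.castHom hdn (ZMod d) v = r, cyclePathMonomial K n t v := by
    simp [classMonomial, map_prod]
  have h0 : classMonomial K hdn r ≠ 0 := Finset.prod_ne_zero_iff.mpr fun v _ => X_ne_zero v
  refine mul_right_cancel₀ h0 ?_
  have h1 := prod_class_add hdn r 1 (cyclePathMonomial K n t)
  have h2 := prod_class_add hdn r (t : ZMod n) (X : ZMod n → MvPolynomial (ZMod n) K)
  rw [map_one] at h1
  rw [map_natCast, (ZMod.natCast_eq_zero_iff _ _).mpr hdt, add_zero] at h2
  rw [h, h, ← h1, classMonomial, ← Finset.prod_mul_distrib]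
  conv_rhs => rw [← h2]
  rw [← Finset.prod_mul_distrib]
  exact Finset.prod_congr rfl fun v _ => cyclePathMonomial_succ_mul K n t v

theorem aeval_classMonomial (K : Type*) [Field K] {t d : ℕ} [NeZero d] (hdn : d ∣ n) (hdt : d ∣ t)
    (r : ZMod d) :
    aeval (cyclePathMonomial K n t) (classMonomial K hdn r) =
      aeval (cyclePathMonomial K n t) (classMonomial K hdn 0) := by
  obtain ⟨m, rfl⟩ := ZMod.natCast_zmod_surjective r
  induction m with
  | zero => simp
  | succ m ih => rw [Nat.cast_succ, aeval_classMonomial_succ K hdn hdt, ih]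

/-- A monomial whose exponents are constant on residue classes, modulo an ideal that identifies the
class monomials. -/
theorem mk_monomial_comp_castHom {K : Type*} [Field K] {d : ℕ} [NeZero d] (hdn : d ∣ n)
    {J : Ideal (MvPolynomial (ZMod n) K)}
    (hJ : ∀ r, Ideal.Quotient.mk J (classMonomial K hdn r) =
      Ideal.Quotient.mk J (classMonomial K hdn 0)) (p : ZMod d → ℕ) :
    Ideal.Quotient.mk J (∏ v, X v ^ p (ZMod.castHom hdn (ZMod d) v)) =
      Ideal.Quotient.mk J (classMonomial K hdn 0) ^ ∑ r, p r := by
  have : ∏ v, (X v : MvPolynomial (ZMod n) K) ^ p (ZMod.castHom hdn (ZMod d) v) =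
      ∏ r, classMonomial K hdn r ^ p r := by
    rw [← Finset.prod_fiberwise _ (ZMod.castHom hdn (ZMod d))]
    refine Finset.prod_congr rfl fun r _ => ?_
    rw [classMonomial, ← Finset.prod_pow]
    refine Finset.prod_congr rfl fun v hv => ?_
    rw [(Finset.mem_filter.mp hv).2]
  rw [this, map_prod]
  simp only [map_pow, hJ, Finset.prod_pow_eq_pow_sum]

/-- N is the common size of the fibres of ℤ/n → ℤ/d; being positive, it can be cancelled when
comparing sums over ℤ/d. -/
theorem sum_comp_castHom {d : ℕ} [NeZero d] (hdn : d ∣ n) :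
    ∃ N : ℕ, 0 < N ∧ ∀ p : ZMod d → ℕ, ∑ v, p (ZMod.castHom hdn (ZMod d) v) = N * ∑ r, p r := by
  have hsurj := ZMod.castHom_surjective hdn
  refine ⟨Finset.card {v | ZMod.castHom hdn (ZMod d) v = 0},
    Finset.card_pos.mpr ⟨0, by rw [Finset.mem_filter]; exact ⟨Finset.mem_univ _, map_zero _⟩⟩, fun p => ?_⟩
  rw [← Finset.sum_fiberwise _ (ZMod.castHom hdn (ZMod d)), Finset.mul_sum]
  refine Finset.sum_congr rfl fun r _ => ?_
  rw [AddMonoidHom.card_fiber_eq_of_mem_range (ZMod.castHom hdn (ZMod d)) (hsurj 0) (hsurj r),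
    ← smul_eq_mul, ← Finset.sum_const]
  refine Finset.sum_congr rfl fun v hv => ?_
  rw [(Finset.mem_filter.mp hv).2]

theorem mk_monomial_eq_of_linearCombination_eq {K : Type*} [Field K] {t d : ℕ} [NeZero d]
    (ht : 0 < t) (hd : d = Nat.gcd n t) (hdn : d ∣ n) {J : Ideal (MvPolynomial (ZMod n) K)}
    (hJ : ∀ r, Ideal.Quotient.mk J (classMonomial K hdn r) =
      Ideal.Quotient.mk J (classMonomial K hdn 0)) {a b : ZMod n →₀ ℕ}
    (hab : Finsupp.linearCombination ℕ (cyclePathExponent n t) a =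
      Finsupp.linearCombination ℕ (cyclePathExponent n t) b) :
    Ideal.Quotient.mk J (monomial a 1) = Ideal.Quotient.mk J (monomial b 1) := by
  obtain ⟨c, hc⟩ : ∃ c : ZMod n → ℤ, ∀ v, c v = a v - b v := ⟨_, fun _ => rfl⟩
  have hc0 (v : ZMod n) : ∑ k ∈ Finset.range t, c (v - k) = 0 := by
    have := DFunLike.congr_fun hab v
    rw [linearCombination_cyclePathExponent_apply,
      linearCombination_cyclePathExponent_apply] at this
    simp only [hc, Finset.sum_sub_distrib]
    exact sub_eq_zero.mpr (by exact_mod_cast this)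
  have hsum : ∑ v, c v = 0 := by
    have := sum_sum_range_sub (t := t) c
    simp only [hc0, Finset.sum_const_zero] at this
    exact (mul_eq_zero.mp this.symm).resolve_left (by exact_mod_cast ht.ne')
  let lift : ZMod d → ZMod n := Function.surjInv (ZMod.castHom_surjective hdn)
  have hper (v : ZMod n) : c (lift (ZMod.castHom hdn (ZMod d) v)) = c v :=
    eq_of_castHom_eq hd hdn c (sub_natCast_eq_of_sum_range_eq_zero c hc0)
      (Function.surjInv_eq (ZMod.castHom_surjective hdn) _)
  -- Positive and negative parts of c, one value per class: a = min(a, b) + p and b = min(a, b) + q.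
  let p : ZMod d → ℕ := fun r => (c (lift r)).toNat
  let q : ZMod d → ℕ := fun r => (-c (lift r)).toNat
  have hp (v) : min (a v) (b v) + p (ZMod.castHom hdn (ZMod d) v) = a v := by
    have := hc v
    simp only [p, hper]; omega
  have hq (v) : min (a v) (b v) + q (ZMod.castHom hdn (ZMod d) v) = b v := by
    have := hc v
    simp only [q, hper]; omega
  have hpq : ∑ r, p r = ∑ r, q r := by
    obtain ⟨N, hN, hN'⟩ := sum_comp_castHom hdn
    refine Nat.eq_of_mul_eq_mul_left hN ?_
    rw [← hN', ← hN']
    have h1 : ∑ v, a v = ∑ v, b v := by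
      have : ∑ v, (a v : ℤ) = ∑ v, (b v : ℤ) := by
        rw [← sub_eq_zero, ← Finset.sum_sub_distrib, ← hsum]
        simp only [hc]
      exact_mod_cast this
    rw [← Finset.sum_congr rfl fun v _ => hp v, ← Finset.sum_congr rfl fun v _ => hq v,
      Finset.sum_add_distrib, Finset.sum_add_distrib] at h1
    exact Nat.add_left_cancel h1
  have key (e : ZMod n →₀ ℕ) (s : ZMod d → ℕ)
      (hs : ∀ v, min (a v) (b v) + s (ZMod.castHom hdn (ZMod d) v) = e v) :
      Ideal.Quotient.mk J (monomial e 1) =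
        Ideal.Quotient.mk J (∏ v, X v ^ min (a v) (b v)) *
          Ideal.Quotient.mk J (classMonomial K hdn 0) ^ ∑ r, s r := by
    rw [← mk_monomial_comp_castHom hdn hJ, ← map_mul, ← Finset.prod_mul_distrib]
    simp only [← pow_add, hs]
    rw [monomial_eq, map_one, one_mul, Finsupp.prod_fintype _ _ (by simp)]
  rw [key a p hp, key b q hq, hpq]

theorem ker_aeval_cyclePathMonomial (K : Type*) [Field K] {t d : ℕ} (ht : 0 < t)
    (hd : d = Nat.gcd n t) :
    RingHom.ker (aeval (cyclePathMonomial K n t) :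
        MvPolynomial (ZMod n) K →ₐ[K] MvPolynomial (ZMod n) K) =
      Ideal.span
        ((fun i => residueMonomial K n d i - residueMonomial K n d d) '' Set.Ico 1 d) := by
  have hdn : d ∣ n := hd ▸ Nat.gcd_dvd_left n t
  have hdt : d ∣ t := hd ▸ Nat.gcd_dvd_right n t
  have : NeZero d := ⟨(Nat.pos_of_dvd_of_pos hdn (NeZero.pos n)).ne'⟩
  simp only [residueMonomial_eq_classMonomial K hdn, ZMod.natCast_self]
  apply le_antisymm
  · rw [funext (cyclePathMonomial_eq_monomial K n t)]
    refine ker_aeval_monomial_le _ _ fun a b hab =>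
      mk_monomial_eq_of_linearCombination_eq ht hd hdn (fun r => ?_) hab
    by_cases hr : r = 0
    · rw [hr]
    · refine Ideal.Quotient.eq.mpr (Ideal.subset_span ⟨r.val, ?_, ?_⟩)
      · exact ⟨Nat.one_le_iff_ne_zero.mpr (mt (ZMod.val_eq_zero r).mp hr), ZMod.val_lt r⟩
      · simp only [ZMod.natCast_zmod_val]
  · rw [Ideal.span_le]
    rintro _ ⟨i, _, rfl⟩
    change aeval (cyclePathMonomial K n t) _ = 0
    rw [map_sub, aeval_classMonomial K hdn hdt, sub_self]

end Cycle

theorem mainTheorem5 (K : Type*) [Field K] (n t d : ℕ) (ht : 1 < t) (htn : t + 1 < n)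
    (hd : d = Nat.gcd n t) :
    Function.Surjective (fiberConeMap (cyclePathGen K ht htn)) ∧
    RingHom.ker (fiberConeMap (cyclePathGen K ht htn)) =
      Ideal.span ((fun i => residueMonomial K n d i - residueMonomial K n d d) '' Set.Ico 1 d) ∧
    RingHom.ker (aeval (cyclePathMonomial K n t) :
        MvPolynomial (ZMod n) K →ₐ[K] MvPolynomial (ZMod n) K) =
      Ideal.span ((fun i => residueMonomial K n d i - residueMonomial K n d d) '' Set.Ico 1 d) := by
  have : NeZero n := ⟨by omega⟩
  have ht0 : 0 < t := by omega
  have hI : pathIdeal K (cycleMod n) t ≤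
      Ideal.span (Set.range fun j => (cyclePathGen K ht htn j : MvPolynomial (ZMod n) K)) :=
    (pathIdeal_cycleMod_eq_span K ht htn).le
  have hhom (j : ZMod n) : (cyclePathMonomial K n t j).IsHomogeneous t := by
    simpa [cyclePathMonomial] using IsHomogeneous.prod (Finset.range t)
      (fun k : ℕ => (X (j + (k : ZMod n)) : MvPolynomial (ZMod n) K)) (fun _ => 1)
      fun k _ => isHomogeneous_X K _
  have hker := ker_aeval_cyclePathMonomial (n := n) K ht0 hd
  exact ⟨fiberConeMap_surjective _ hI, (ker_fiberConeMap ht0 _ hI hhom).trans hker, hker⟩
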